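/- Let $X$ be a real or complex Banach space and let $A : D(A)\subset X\to X$ be a densely defined linear operator. The resolvent set $\rho(A)$ is the set of scalars $\lambda$ for which $\lambda I-A : D(A)\to X$ is bijective with bounded inverse. For $\tau>0$ with $1/\tau\in\rho(A)$ put $V_\tau=(\tau A+I)(\tau A-I)^{-1}$, which is a bounded linear operator on $X$. (a) If there exists $\tau_0>0$ such that $(1/\tau_0,\infty)\subset\rho(A)$ and $\|V_\tau\|\le 1$ for every $\tau\in(0,\tau_0)$, then $A$ generates a $C_0$-semigroup $(T(t))_{t\ge 0}$ with $\|T(t)\|\le 1$ for all $t\ge 0$. (b) Let $M\in\mathbb{R}$. If there exists $\tau_0>0$ such that $(1/\tau_0,\infty)\subset\rho(A)$ and $\|V_\tau^n\|\le M$ for all $\tau\in(0,\tau_0)$ and all integers $n\ge 1$, then $A$ generates a $C_0$-semigroup $(T(t))_{t\ge 0}$ with $\|T(t)\|\le M$ for all $t\ge 0$. -/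

import Mathlib

open scoped NNReal Topology

namespace Cogen

variable {𝕜 X : Type*} [RCLike 𝕜] [NormedAddCommGroup X] [NormedSpace 𝕜 X]

/-- For a (not necessarily bounded) linear operator `A` with domain `D(A)`, the operator
`a A + b I` with the same domain `D(A)`. -/
def affine (A : X →ₗ.[𝕜] X) (a b : 𝕜) : X →ₗ.[𝕜] X where
  domain := A.domain
  toFun := a • A.toFun + b • A.domain.subtype

/-- `R` is a bounded, everywhere defined, two-sided inverse of the operator `B : D(B) → X`. -/
structure IsBoundedInverse (B : X →ₗ.[𝕜] X) (R : X →L[𝕜] X) : Prop where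
  left_inv : ∀ x : B.domain, R (B x) = x
  mem_domain : ∀ y : X, R y ∈ B.domain
  right_inv : ∀ y : X, B ⟨R y, mem_domain y⟩ = y

/-- The resolvent set `ρ(A)`: those `z` for which `z I - A : D(A) → X` is bijective with bounded
inverse. -/
def resolventSet (A : X →ₗ.[𝕜] X) : Set 𝕜 :=
  {z | ∃ R : X →L[𝕜] X, IsBoundedInverse (affine A (-1) z) R}

/-- If `R = (τ A - I)⁻¹`, this is the bounded operator `y ↦ (τ A + I) (R y)`. -/
def cayleyOfInverse (A : X →ₗ.[𝕜] X) (τ : ℝ) (R : X →L[𝕜] X)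
    (h : IsBoundedInverse (affine A (τ : 𝕜) (-1)) R) : X →L[𝕜] X where
  toLinearMap := (affine A (τ : 𝕜) 1).toFun.comp
    ((R : X →ₗ[𝕜] X).codRestrict A.domain h.mem_domain)
  cont := by
    have key : ∀ y : X, (affine A (τ : 𝕜) 1).toFun ⟨R y, h.mem_domain y⟩ = y + (2 : 𝕜) • R y := by
      intro y
      have h1 : (τ : 𝕜) • A.toFun ⟨R y, h.mem_domain y⟩ + (-1 : 𝕜) • R y = y := h.right_inv y
      have h2 : (affine A (τ : 𝕜) 1).toFun ⟨R y, h.mem_domain y⟩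
        = (τ : 𝕜) • A.toFun ⟨R y, h.mem_domain y⟩ + (1 : 𝕜) • R y := rfl
      rw [h2]
      conv_rhs => lhs; rw [← h1]
      module
    change Continuous fun y : X => (affine A (τ : 𝕜) 1).toFun ⟨R y, h.mem_domain y⟩
    simp_rw [key]
    fun_prop

open Classical in
/-- The operator `V_τ = (τ A + I) (τ A - I)⁻¹`. For `τ ≠ 0` the inverse of `τ A - I` exists as a
bounded operator exactly when `1 / τ ∈ ρ(A)`; when it does not exist the value is `0` by
convention. -/
noncomputable def V (A : X →ₗ.[𝕜] X) (τ : ℝ) : X →L[𝕜] X :=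
  if h : ∃ R : X →L[𝕜] X, IsBoundedInverse (affine A (τ : 𝕜) (-1)) R then
    cayleyOfInverse A τ h.choose h.choose_spec
  else 0

/-- `(T(t))_{t ≥ 0}` is a strongly continuous semigroup of bounded operators. -/
structure IsC0Semigroup (T : ℝ≥0 → X →L[𝕜] X) : Prop where
  map_zero : T 0 = 1
  map_add : ∀ s t : ℝ≥0, T (s + t) = T s * T t
  strong_cont : ∀ x : X, Continuous fun t : ℝ≥0 => T t x

/-- `A` is the generator of `T`: `x ∈ D(A)` and `A x = y` precisely when
`(T(t) x - x) / t → y` as `t ↓ 0`. In particular `D(A)` is the set of all `x` for which that limit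
exists. -/
def IsGenerator (A : X →ₗ.[𝕜] X) (T : ℝ≥0 → X →L[𝕜] X) : Prop :=
  ∀ x y : X, (x, y) ∈ A.graph ↔
    Filter.Tendsto (fun t : ℝ≥0 => (((t : ℝ)⁻¹ : ℝ) : 𝕜) • (T t x - x)) (𝓝[>] 0) (𝓝 y)

end Cogen

/-! With `J_τ = (I - τA)⁻¹` one has `V_τ = I - 2 J_τ`, so `J_τ = (I - V_τ)/2` is an average and
inherits power bounds from `V_τ` (`norm_pow_le_of_eq_one_sub_two_smul`). This is the Hille–Yosida
condition with growth bound zero.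

Take `τ_n → 0` and the bounded Yosida approximations `B_n = (J_n - I)/τ_n`. Expanding `exp(tB_n) =
exp(-t/τ_n) exp((t/τ_n) J_n)` bounds these semigroups uniformly. The `B_n` commute and converge to
`A` on the dense domain, so the exponentials converge strongly to a semigroup
(`exists_isC0Semigroup_of_tendsto`) whose generator extends `A`. Commutation with `J_0` shows that
the generator is no larger. Part (a) is part (b) with `M = 1`. -/

namespace Cogen

open Filter NormedSpace

/-! ### Exponentials of bounded operators, with estimates independent of the operator norm. -/

section Exponential

/-- If `P` is power bounded by `M`, then so is the semigroup generated by `P - 1`. -/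
theorem norm_exp_smul_sub_one_le {𝕜 R : Type*} [RCLike 𝕜] [NormedRing R] [NormedAlgebra 𝕜 R]
    [CompleteSpace R] {P : R} {M : ℝ} (hP : ∀ n : ℕ, ‖P ^ n‖ ≤ M) {s : ℝ} (hs : 0 ≤ s) :
    ‖exp ((s : 𝕜) • (P - 1))‖ ≤ M := by
  let _ : NormedAlgebra ℝ R := NormedAlgebra.restrictScalars ℝ 𝕜 R
  let _ : NormedAlgebra ℚ R := NormedAlgebra.restrictScalars ℚ ℝ R
  have hexp : ‖exp ((s : 𝕜) • P)‖ ≤ Real.exp s * M := by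
    have h1 := exp_series_hasSum_exp' (𝕂 := 𝕜) ((s : 𝕜) • P)
    have h2 : HasSum (fun n : ℕ => ((n.factorial : ℝ)⁻¹ • s ^ n) * M) (Real.exp s * M) := by
      rw [Real.exp_eq_exp_ℝ]
      exact (exp_series_hasSum_exp' (𝕂 := ℝ) s).mul_right M
    rw [← h1.tsum_eq]
    refine tsum_of_norm_bounded h2 fun n => ?_
    rw [smul_pow, smul_smul, norm_smul]
    refine mul_le_mul ?_ (hP n) (norm_nonneg _) (by positivity)
    simp [abs_of_nonneg hs]
  have hsub : (s : 𝕜) • (P - 1) = (s : 𝕜) • P + algebraMap 𝕜 R (-(s : 𝕜)) := by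
    rw [Algebra.algebraMap_eq_smul_one]
    module
  rw [hsub, exp_add_of_commute (Algebra.commutes _ _).symm, ← algebraMap_exp_comm,
    ← Algebra.commutes, ← Algebra.smul_def, norm_smul]
  have hnorm : ‖exp (-(s : 𝕜))‖ = Real.exp (-s) := by
    rw [← RCLike.ofReal_neg, ← RCLike.algebraMap_eq_ofReal, ← algebraMap_exp_comm,
      Real.exp_eq_exp_ℝ, RCLike.algebraMap_eq_ofReal, RCLike.norm_ofReal, ← Real.exp_eq_exp_ℝ,
      abs_of_pos (Real.exp_pos _)]
  rw [hnorm]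
  calc _ ≤ Real.exp (-s) * (Real.exp s * M) := by gcongr
    _ = M := by rw [← mul_assoc, ← Real.exp_add]; simp

variable {𝕜 X : Type*} [RCLike 𝕜] [NormedAddCommGroup X] [NormedSpace 𝕜 X] [CompleteSpace X]

theorem hasDerivAt_exp_smul_apply (B : X →L[𝕜] X) (x : X) (u : 𝕜) :
    HasDerivAt (fun u : 𝕜 => exp (u • B) x) (exp (u • B) (B x)) u := by
  have := (hasDerivAt_exp_smul_const B u).clm_apply (hasDerivAt_const u x)
  simpa using this

/-- Lets the mean value inequality over `𝕜` be applied along a real interval embedded in `𝕜`. -/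
theorem convex_image_ofReal {s : Set ℝ} (hs : Convex ℝ s) :
    Convex ℝ ((fun r : ℝ => (r : 𝕜)) '' s) :=
  hs.linear_image (RCLike.ofRealLI (K := 𝕜)).toLinearMap

theorem norm_exp_apply_sub_exp_apply_le {B : X →L[𝕜] X} {M : ℝ}
    (hB : ∀ t : ℝ, 0 ≤ t → ‖exp ((t : 𝕜) • B)‖ ≤ M) (x : X) {s t : ℝ} (hs : 0 ≤ s) (ht : 0 ≤ t) :
    ‖exp ((t : 𝕜) • B) x - exp ((s : 𝕜) • B) x‖ ≤ M * ‖B x‖ * |t - s| := by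
  have h := Convex.norm_image_sub_le_of_norm_hasDerivWithin_le (𝕜 := 𝕜)
    (f := fun u : 𝕜 => exp (u • B) x) (s := (fun r : ℝ => (r : 𝕜)) '' Set.Ici 0)
    (C := M * ‖B x‖) (fun u _ => (hasDerivAt_exp_smul_apply B x u).hasDerivWithinAt)
    (by
      rintro _ ⟨r, hr, rfl⟩
      exact (exp ((r : 𝕜) • B)).le_of_opNorm_le (hB r hr) _)
    (convex_image_ofReal (convex_Ici 0)) ⟨s, hs, rfl⟩ ⟨t, ht, rfl⟩
  rwa [← RCLike.ofReal_sub, RCLike.norm_ofReal] at h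

theorem norm_exp_apply_sub_self_le {B : X →L[𝕜] X} {M : ℝ}
    (hB : ∀ t : ℝ, 0 ≤ t → ‖exp ((t : 𝕜) • B)‖ ≤ M) (x : X) {t : ℝ} (ht : 0 ≤ t) :
    ‖exp ((t : 𝕜) • B) x - x‖ ≤ M * ‖B x‖ * t := by
  simpa [abs_of_nonneg ht] using norm_exp_apply_sub_exp_apply_le hB x le_rfl ht

/-- A first order Taylor estimate, uniform in `‖B‖`. -/
theorem norm_exp_apply_sub_sub_le {B : X →L[𝕜] X} {M : ℝ}
    (hB : ∀ t : ℝ, 0 ≤ t → ‖exp ((t : 𝕜) • B)‖ ≤ M) (x y : X) {t : ℝ} (ht : 0 ≤ t) :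
    ‖exp ((t : 𝕜) • B) x - x - (t : 𝕜) • B x‖ ≤
      ((M + 1) * ‖B x - y‖ + M * ‖B y‖ * t) * t := by
  have hM : 0 ≤ M := (norm_nonneg _).trans (hB 0 le_rfl)
  have h := Convex.norm_image_sub_le_of_norm_hasDerivWithin_le (𝕜 := 𝕜)
    (f := fun u : 𝕜 => exp (u • B) x - u • B x) (f' := fun u : 𝕜 => exp (u • B) (B x) - B x)
    (s := (fun r : ℝ => (r : 𝕜)) '' Set.Icc 0 t)
    (C := (M + 1) * ‖B x - y‖ + M * ‖B y‖ * t)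
    (fun u _ => by
      have h2 := (hasDerivAt_id u).smul_const (B x)
      rw [one_smul] at h2
      exact ((hasDerivAt_exp_smul_apply B x u).sub h2).hasDerivWithinAt)
    (by
      rintro _ ⟨r, hr, rfl⟩
      -- Applying the Lipschitz bound to `B x` itself would involve `B (B x)`, which is not
      -- controlled in the limit; `y` replaces `B x` there.
      have e : exp ((r : 𝕜) • B) (B x) - B x =
          exp ((r : 𝕜) • B) (B x - y) + -(B x - y) + (exp ((r : 𝕜) • B) y - y) := by
        rw [map_sub]; abel
      dsimp only
      rw [e]
      have h1 := (exp ((r : 𝕜) • B)).le_of_opNorm_le (hB r hr.1) (B x - y)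
      have h2 := norm_exp_apply_sub_self_le hB y hr.1
      have h3 : M * ‖B y‖ * r ≤ M * ‖B y‖ * t := by gcongr; exact hr.2
      refine (norm_add₃_le).trans ?_
      rw [norm_neg]
      linarith)
    (convex_image_ofReal (convex_Icc 0 t)) ⟨0, ⟨le_rfl, ht⟩, rfl⟩ ⟨t, ⟨ht, le_rfl⟩, rfl⟩
  have e : exp ((t : 𝕜) • B) x - x - (t : 𝕜) • B x =
      exp ((t : 𝕜) • B) x - (t : 𝕜) • B x - x := by abel
  rw [e]
  simpa [abs_of_nonneg ht] using h

/-- The path `u ↦ exp(uB) exp((t-u)C) x` joins the two vectors. By commutativity its derivative is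
`exp(uB) exp((t-u)C) (B-C) x`, and each exponential costs one factor `M`. -/
theorem norm_exp_apply_sub_exp_apply_le_of_commute {B C : X →L[𝕜] X} (hBC : Commute B C) {M : ℝ}
    (hB : ∀ t : ℝ, 0 ≤ t → ‖exp ((t : 𝕜) • B)‖ ≤ M)
    (hC : ∀ t : ℝ, 0 ≤ t → ‖exp ((t : 𝕜) • C)‖ ≤ M) (x : X) {t : ℝ} (ht : 0 ≤ t) :
    ‖exp ((t : 𝕜) • B) x - exp ((t : 𝕜) • C) x‖ ≤ M * (M * ‖B x - C x‖) * t := by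
  let _ : NormedAlgebra ℝ (X →L[𝕜] X) := NormedAlgebra.restrictScalars ℝ 𝕜 _
  let _ : NormedAlgebra ℚ (X →L[𝕜] X) := NormedAlgebra.restrictScalars ℚ ℝ _
  have hM : 0 ≤ M := (norm_nonneg _).trans (hB 0 le_rfl)
  have key : ∀ u : 𝕜, exp (u • (B - C)) * exp ((t : 𝕜) • C) =
      exp (u • B) * exp (((t : 𝕜) - u) • C) := by
    intro u
    rw [← exp_add_of_commute, ← exp_add_of_commute]
    · congr 1; module
    · exact (hBC.smul_left u).smul_right _
    · exact ((hBC.sub_left (Commute.refl C)).smul_left u).smul_right _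
  have hcomm : Commute (B - C) (exp ((t : 𝕜) • C)) :=
    ((hBC.sub_left (Commute.refl C)).smul_right _).exp_right
  have h := Convex.norm_image_sub_le_of_norm_hasDerivWithin_le (𝕜 := 𝕜)
    (f := fun u : 𝕜 => exp (u • (B - C)) (exp ((t : 𝕜) • C) x))
    (s := (fun r : ℝ => (r : 𝕜)) '' Set.Icc 0 t) (C := M * (M * ‖B x - C x‖))
    (fun u _ => (hasDerivAt_exp_smul_apply (B - C) _ u).hasDerivWithinAt)
    (by
      rintro _ ⟨r, hr, rfl⟩
      have e1 : (B - C) (exp ((t : 𝕜) • C) x) = exp ((t : 𝕜) • C) ((B - C) x) :=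
        congrArg (fun F : X →L[𝕜] X => F x) hcomm.eq
      have e2 := congrArg (fun F : X →L[𝕜] X => F ((B - C) x)) (key r)
      simp only [mul_apply_eq_comp] at e2
      dsimp only
      rw [e1, e2, ← RCLike.ofReal_sub]
      refine ContinuousLinearMap.le_of_opNorm_le_of_le _ (hB r hr.1) ?_
      exact ContinuousLinearMap.le_of_opNorm_le _ (hC _ (sub_nonneg.2 hr.2)) _)
    (convex_image_ofReal (convex_Icc 0 t)) ⟨0, ⟨le_rfl, ht⟩, rfl⟩ ⟨t, ⟨ht, le_rfl⟩, rfl⟩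
  have e2 := congrArg (fun F : X →L[𝕜] X => F x) (key t)
  simp only [mul_apply_eq_comp, sub_self, zero_smul, exp_zero,
    one_apply_eq_self] at e2
  simp only [e2] at h
  simpa [abs_of_nonneg ht] using h

end Exponential


/-! ### Strong limits on a dense subspace and the limit semigroup. -/

section Approximation

variable {𝕜 X : Type*} [RCLike 𝕜] [NormedAddCommGroup X] [NormedSpace 𝕜 X]

theorem cauchySeq_apply_of_dense {F : ℕ → X →L[𝕜] X} {C : ℝ} (hF : ∀ n, ‖F n‖ ≤ C) {D : Set X}
    (hD : Dense D) (h : ∀ x ∈ D, CauchySeq fun n => F n x) (x : X) :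
    CauchySeq fun n => F n x := by
  have hC : 0 ≤ C := (norm_nonneg _).trans (hF 0)
  rw [Metric.cauchySeq_iff']
  intro ε hε
  obtain ⟨y, hy, hxy⟩ := hD.exists_dist_lt x (show 0 < ε / (3 * (C + 1)) by positivity)
  obtain ⟨N, hN⟩ := Metric.cauchySeq_iff'.1 (h y hy) (ε / 3) (by positivity)
  refine ⟨N, fun n hn => ?_⟩
  have hb : ∀ m, dist (F m x) (F m y) < ε / 3 := fun m => by
    rw [dist_eq_norm, ← map_sub]
    calc _ ≤ C * ‖x - y‖ := (F m).le_of_opNorm_le (hF m) _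
      _ ≤ (C + 1) * ‖x - y‖ := by gcongr; linarith
      _ < (C + 1) * (ε / (3 * (C + 1))) := by rw [← dist_eq_norm]; gcongr
      _ = ε / 3 := by field_simp
  have h1 := dist_triangle4 (F n x) (F n y) (F N y) (F N x)
  have h2 := hb N
  rw [dist_comm] at h2
  linarith [hb n, hN n hn]

theorem tendsto_apply_of_dense {F : ℕ → X →L[𝕜] X} {G : X →L[𝕜] X} {C : ℝ}
    (hF : ∀ n, ‖F n‖ ≤ C) {D : Set X} (hD : Dense D)
    (h : ∀ x ∈ D, Tendsto (fun n => F n x) atTop (𝓝 (G x))) (x : X) :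
    Tendsto (fun n => F n x) atTop (𝓝 (G x)) := by
  have hC : 0 ≤ C := (norm_nonneg _).trans (hF 0)
  set K := C + ‖G‖ + 1
  have hK : 0 < K := by positivity
  have hFG : ∀ n, ‖F n - G‖ ≤ K := fun n => by
    have := norm_sub_le (F n) G
    linarith [hF n]
  rw [Metric.tendsto_atTop]
  intro ε hε
  obtain ⟨y, hy, hxy⟩ := hD.exists_dist_lt x (show 0 < ε / (2 * K) by positivity)
  obtain ⟨N, hN⟩ := Metric.tendsto_atTop.1 (h y hy) (ε / 2) (by positivity)
  refine ⟨N, fun n hn => ?_⟩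
  have h1 : ‖(F n - G) (x - y)‖ < ε / 2 := by
    calc _ ≤ K * ‖x - y‖ := (F n - G).le_of_opNorm_le (hFG n) _
      _ < K * (ε / (2 * K)) := by rw [← dist_eq_norm]; gcongr
      _ = ε / 2 := by field_simp
  have h2 := hN n hn
  rw [dist_eq_norm] at h2 ⊢
  have e : F n x - G x = (F n - G) (x - y) + (F n y - G y) := by
    simp only [sub_apply, map_sub]; abel
  rw [e]
  exact (norm_add_le _ _).trans_lt (by linarith)

theorem continuous_apply_of_dense {ι : Type*} [TopologicalSpace ι] {T : ι → X →L[𝕜] X} {M : ℝ}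
    (hT : ∀ t, ‖T t‖ ≤ M) {D : Set X} (hD : Dense D)
    (h : ∀ x ∈ D, Continuous fun t => T t x) (x : X) : Continuous fun t => T t x := by
  refine continuous_of_uniform_approx_of_continuous fun u hu => ?_
  obtain ⟨ε, hε, hu⟩ := Metric.mem_uniformity_dist.1 hu
  set K := |M| + 1
  have hK : 0 < K := by positivity
  obtain ⟨y, hy, hxy⟩ := hD.exists_dist_lt x (show 0 < ε / K by positivity)
  refine ⟨fun t => T t y, h y hy, fun t => hu ?_⟩
  rw [dist_eq_norm, ← map_sub]
  calc _ ≤ K * ‖x - y‖ := (T t).le_of_opNorm_le ((hT t).trans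
          ((le_abs_self M).trans (by simp [K]))) _
    _ < K * (ε / K) := by rw [← dist_eq_norm]; gcongr
    _ = ε := by field_simp

variable [CompleteSpace X]

/-- Semigroups with commuting generators `B n` and a common bound converge to a strongly
continuous semigroup if the `B n` converge pointwise on a dense subspace. -/
theorem exists_isC0Semigroup_of_tendsto {B : ℕ → X →L[𝕜] X} {M : ℝ}
    (hM : ∀ n (t : ℝ), 0 ≤ t → ‖exp ((t : 𝕜) • B n)‖ ≤ M) (hB : ∀ m n, Commute (B m) (B n))
    {D : Submodule 𝕜 X} (hD : Dense (D : Set X)) {G : D → X}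
    (hG : ∀ x : D, Tendsto (fun n => B n x) atTop (𝓝 (G x))) :
    ∃ T : ℝ≥0 → X →L[𝕜] X, IsC0Semigroup T ∧ (∀ t, ‖T t‖ ≤ M) ∧
      (∀ S : X →L[𝕜] X, (∀ n, Commute S (B n)) → ∀ t, Commute S (T t)) ∧
      ∀ x : D, Tendsto (fun t : ℝ≥0 => (((t : ℝ)⁻¹ : ℝ) : 𝕜) • (T t x - x)) (𝓝[>] 0)
        (𝓝 (G x)) := by
  let _ : NormedAlgebra ℝ (X →L[𝕜] X) := NormedAlgebra.restrictScalars ℝ 𝕜 _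
  let _ : NormedAlgebra ℚ (X →L[𝕜] X) := NormedAlgebra.restrictScalars ℚ ℝ _
  have hM0 : 0 ≤ M := (norm_nonneg _).trans (hM 0 0 le_rfl)
  have hcauchy : ∀ (t : ℝ≥0) (x : X), CauchySeq fun n => exp (((t : ℝ) : 𝕜) • B n) x := by
    intro t
    refine cauchySeq_apply_of_dense (fun n => hM n t t.2) hD fun x hx => ?_
    have hc := (hG ⟨x, hx⟩).cauchySeq
    rw [Metric.cauchySeq_iff] at hc ⊢
    intro ε hε
    obtain ⟨N, hN⟩ := hc (ε / (M * M * t + 1)) (by positivity)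
    refine ⟨N, fun m hm n hn => ?_⟩
    have h1 := norm_exp_apply_sub_exp_apply_le_of_commute (hB m n) (hM m) (hM n) x t.2
    have h2 := hN m hm n hn
    rw [dist_eq_norm] at h2 ⊢
    rw [lt_div_iff₀ (by positivity)] at h2
    refine h1.trans_lt (lt_of_le_of_lt ?_ h2)
    simp only [NNReal.val_eq_coe]
    nlinarith [norm_nonneg (B m x - B n x)]
  choose F hF using fun t x => cauchySeq_tendsto_of_complete (hcauchy t x)
  let T : ℝ≥0 → X →L[𝕜] X := fun t =>
    continuousLinearMapOfTendsto (fun n => exp (((t : ℝ) : 𝕜) • B n)) (tendsto_pi_nhds.2 (hF t))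
  have hT : ∀ (t : ℝ≥0) x, Tendsto (fun n => exp (((t : ℝ) : 𝕜) • B n) x) atTop (𝓝 (T t x)) := hF
  have hTM : ∀ t, ‖T t‖ ≤ M := fun t => ContinuousLinearMap.opNorm_le_bound _ hM0 fun x =>
    le_of_tendsto (hT t x).norm
      (Eventually.of_forall fun n => ContinuousLinearMap.le_of_opNorm_le _ (hM n t t.2) x)
  -- The bound for `B n` sees only `‖B n x‖`, which tends to `‖G x‖`, so it survives the limit.
  have hlip : ∀ (x : D) (s t : ℝ≥0), ‖T t x - T s x‖ ≤ M * ‖G x‖ * |(t : ℝ) - s| := fun x s t =>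
    le_of_tendsto_of_tendsto ((hT t x).sub (hT s x)).norm
      (((hG x).norm.const_mul M).mul_const _)
      (Eventually.of_forall fun n => norm_exp_apply_sub_exp_apply_le (hM n) _ s.2 t.2)
  refine ⟨T, ⟨?_, ?_, ?_⟩, hTM, ?_, ?_⟩
  · ext x
    refine tendsto_nhds_unique (hT 0 x) ?_
    simp
  · intro s t
    ext x
    refine tendsto_nhds_unique (hT (s + t) x) ?_
    have h1 : ∀ n, exp ((((s + t : ℝ≥0) : ℝ) : 𝕜) • B n) x =
        exp (((s : ℝ) : 𝕜) • B n) (exp (((t : ℝ) : 𝕜) • B n) x - T t x) +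
          exp (((s : ℝ) : 𝕜) • B n) (T t x) := by
      intro n
      rw [← map_add, sub_add_cancel, ← mul_apply_eq_comp, ← exp_add_of_commute
        (((Commute.refl (B n)).smul_left _).smul_right _), ← add_smul]
      push_cast
      rfl
    simp_rw [h1]
    rw [show (T s * T t) x = 0 + T s (T t x) by simp]
    refine Tendsto.add (squeeze_zero_norm (a := fun n => M * ‖exp (((t : ℝ) : 𝕜) • B n) x - T t x‖)
      (fun n => ContinuousLinearMap.le_of_opNorm_le _ (hM n s s.2) _) ?_) (hT s _)
    simpa using (((hT t x).sub_const (T t x)).norm).const_mul M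
  · refine continuous_apply_of_dense hTM hD fun x hx => ?_
    refine (LipschitzWith.of_dist_le_mul (K := ⟨M * ‖G ⟨x, hx⟩‖, by positivity⟩)
      fun t s => ?_).continuous
    rw [dist_eq_norm, NNReal.dist_eq]
    exact hlip ⟨x, hx⟩ s t
  · intro S hS t
    ext x
    refine tendsto_nhds_unique ((S.continuous.tendsto _).comp (hT t x)) ?_
    refine (hT t (S x)).congr fun n => ?_
    exact congrArg (fun F : X →L[𝕜] X => F x) ((hS n).smul_right _).exp_right.eq.symm
  · intro x
    have hbound : ∀ (y : D) (t : ℝ≥0), ‖T t x - x - ((t : ℝ) : 𝕜) • G x‖ ≤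
        ((M + 1) * ‖G x - y‖ + M * ‖G y‖ * t) * t := fun y t =>
      le_of_tendsto_of_tendsto
        (((hT t x).sub_const (x : X)).sub ((hG x).const_smul ((t : ℝ) : 𝕜))).norm
        ((((((hG x).sub_const (y : X)).norm).const_mul _).add
          (((hG y).norm.const_mul M).mul_const _)).mul_const _)
        (Eventually.of_forall fun n => norm_exp_apply_sub_sub_le (hM n) _ _ t.2)
    rw [Metric.tendsto_nhds]
    intro ε hε
    -- `G x` may lie outside `D`; a nearby `y ∈ D` makes the first term of `hbound` less than `ε /
    -- 2`, and small `t` handles the second.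
    obtain ⟨y, hy, hxy⟩ := hD.exists_dist_lt (G x) (show 0 < ε / (2 * (M + 1)) by positivity)
    have hsmall : Tendsto (fun t : ℝ≥0 => M * ‖G ⟨y, hy⟩‖ * (t : ℝ)) (𝓝[>] 0) (𝓝 0) := by
      have : Continuous fun t : ℝ≥0 => M * ‖G ⟨y, hy⟩‖ * (t : ℝ) := by fun_prop
      simpa using (this.tendsto 0).mono_left nhdsWithin_le_nhds
    filter_upwards [hsmall.eventually_lt_const (half_pos hε), self_mem_nhdsWithin] with t ht ht0
    have ht0 : (0 : ℝ) < t := ht0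
    have htk : ((t : ℝ) : 𝕜) ≠ 0 := by exact_mod_cast ht0.ne'
    have e : (((t : ℝ)⁻¹ : ℝ) : 𝕜) • (T t x - x) - G x =
        (((t : ℝ)⁻¹ : ℝ) : 𝕜) • (T t x - x - ((t : ℝ) : 𝕜) • G x) := by
      rw [smul_sub _ (T t x - x), smul_smul, RCLike.ofReal_inv, inv_mul_cancel₀ htk, one_smul]
    rw [dist_eq_norm, e, norm_smul, RCLike.norm_ofReal, abs_of_pos (inv_pos.2 ht0),
      inv_mul_lt_iff₀ ht0, mul_comm (t : ℝ)]
    refine (hbound ⟨y, hy⟩ t).trans_lt (mul_lt_mul_of_pos_right ?_ ht0)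
    rw [dist_eq_norm, lt_div_iff₀ (by positivity)] at hxy
    linarith

end Approximation


/-! ### Resolvents, the Cayley transform, and generation. -/

section Resolvent

variable {𝕜 X : Type*} [RCLike 𝕜] [NormedAddCommGroup X] [NormedSpace 𝕜 X] {A : X →ₗ.[𝕜] X}

theorem affine_apply (a b : 𝕜) (x : A.domain) : affine A a b x = a • A x + b • (x : X) := rfl

theorem IsBoundedInverse.apply_sub {t : 𝕜} {J : X →L[𝕜] X}
    (h : IsBoundedInverse (affine A (-t) 1) J) (x : A.domain) : J (x - t • A x) = x := by
  have h1 : J (-t • A x + (1 : 𝕜) • (x : X)) = x := h.left_inv x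
  rw [← h1]
  congr 1
  rw [h1]
  module

theorem IsBoundedInverse.sub_apply {t : 𝕜} {J : X →L[𝕜] X}
    (h : IsBoundedInverse (affine A (-t) 1) J) (y : X) :
    J y - t • A ⟨J y, h.mem_domain y⟩ = y := by
  have h1 : -t • A ⟨J y, h.mem_domain y⟩ + (1 : 𝕜) • J y = y := h.right_inv y
  conv_rhs => rw [← h1]
  module

theorem IsBoundedInverse.apply_sub_self {t : 𝕜} {J : X →L[𝕜] X}
    (h : IsBoundedInverse (affine A (-t) 1) J) (x : A.domain) : J x - x = t • J (A x) := by
  have h1 := h.apply_sub x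
  rw [map_sub, map_smul] at h1
  rw [sub_eq_iff_eq_add] at h1
  rw [sub_eq_iff_eq_add, add_comm]
  exact h1

/-- `s J_s - t J_t = (s - t) J_t J_s` for `J_t = (I - t A)⁻¹`. -/
theorem IsBoundedInverse.smul_sub_smul {s t : 𝕜} {J K : X →L[𝕜] X}
    (hJ : IsBoundedInverse (affine A (-s) 1) J) (hK : IsBoundedInverse (affine A (-t) 1) K)
    (y : X) : s • J y - t • K y = (s - t) • K (J y) := by
  have h1 := hK.apply_sub ⟨J y, hJ.mem_domain y⟩
  have h2 := congrArg K (hJ.sub_apply y)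
  simp only [map_sub, map_smul] at h1 h2
  rw [← h2]
  nth_rewrite 1 [← h1]
  module

/-- For `s ≠ t`, compare the resolvent identity with its version with the roles swapped; for `s = t`
the inverse is unique. -/
theorem IsBoundedInverse.commute {s t : 𝕜} {J K : X →L[𝕜] X}
    (hJ : IsBoundedInverse (affine A (-s) 1) J) (hK : IsBoundedInverse (affine A (-t) 1) K) :
    Commute J K := by
  rcases eq_or_ne s t with rfl | hst
  · have : J = K := by
      ext y
      have h1 := hK.apply_sub ⟨J y, hJ.mem_domain y⟩
      rw [hJ.sub_apply] at h1
      exact h1.symm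
    rw [this]
  · ext y
    have h1 := hJ.smul_sub_smul hK y
    have h2 := hK.smul_sub_smul hJ y
    have h3 : (s - t) • J (K y) = (s - t) • K (J y) := by
      rw [← h1, ← neg_sub t s, neg_smul, ← h2]
      abel
    exact smul_right_injective X (sub_ne_zero.2 hst) h3

/-- `V_τ = I - 2 (I - τ A)⁻¹`. -/
theorem exists_isBoundedInverse_and_V_eq {τ : ℝ} (hτ : 0 < τ)
    (h : ((1 / τ : ℝ) : 𝕜) ∈ resolventSet A) :
    ∃ J : X →L[𝕜] X, IsBoundedInverse (affine A (-(τ : 𝕜)) 1) J ∧ V A τ = 1 - (2 : 𝕜) • J := by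
  have hτ' : (τ : 𝕜) ≠ 0 := by exact_mod_cast hτ.ne'
  have hex : ∃ R : X →L[𝕜] X, IsBoundedInverse (affine A (τ : 𝕜) (-1)) R := by
    obtain ⟨R, hR⟩ := h
    have e : ∀ x : A.domain, affine A (τ : 𝕜) (-1) x =
        (-(τ : 𝕜)) • affine A (-1) ((1 / τ : ℝ) : 𝕜) x := fun x => by
      rw [affine_apply, affine_apply, smul_add, smul_smul, smul_smul]
      push_cast
      congr 2
      · ring
      · field_simp
    refine ⟨(-(τ : 𝕜))⁻¹ • R, ⟨fun x => ?_, fun y => A.domain.smul_mem _ (hR.mem_domain y),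
      fun y => ?_⟩⟩
    · rw [e x, map_smul, _root_.smul_apply, smul_smul, mul_inv_cancel₀
        (neg_ne_zero.2 hτ'), one_smul]
      exact hR.left_inv x
    · refine (e _).trans ((congrArg (fun z => (-(τ : 𝕜)) • z)
        ((affine A (-1) ((1 / τ : ℝ) : 𝕜)).map_smul (-(τ : 𝕜))⁻¹ ⟨R y, hR.mem_domain y⟩)).trans ?_)
      change -(τ : 𝕜) • (-(τ : 𝕜))⁻¹ • _ = y
      rw [smul_smul, mul_inv_cancel₀ (neg_ne_zero.2 hτ'), one_smul]
      exact hR.right_inv y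
  -- Taking the very inverse chosen inside `V` avoids an appeal to uniqueness.
  obtain ⟨R, hR, hV⟩ : ∃ (R : X →L[𝕜] X) (hR : IsBoundedInverse (affine A (τ : 𝕜) (-1)) R),
      V A τ = cayleyOfInverse A τ R hR := ⟨_, _, dif_pos hex⟩
  have hAR : ∀ y, ∃ z : A.domain, (τ : 𝕜) • A z + (-1 : 𝕜) • R y = y ∧
      (∀ h : (-R) y ∈ A.domain, A ⟨(-R) y, h⟩ = -A z) ∧
      cayleyOfInverse A τ R hR y = (τ : 𝕜) • A z + (1 : 𝕜) • R y := fun y =>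
    ⟨⟨R y, hR.mem_domain y⟩, hR.right_inv y, fun _ => A.map_neg ⟨R y, hR.mem_domain y⟩, rfl⟩
  refine ⟨-R, ⟨fun (x : A.domain) => ?_, fun y => A.domain.neg_mem (hR.mem_domain y),
    fun y => ?_⟩, ?_⟩
  · have h1 : R ((τ : 𝕜) • A x + (-1 : 𝕜) • (x : X)) = x := hR.left_inv x
    change -R (-(τ : 𝕜) • A x + (1 : 𝕜) • (x : X)) = x
    rw [← map_neg, ← h1]
    congr 1
    rw [h1]
    module
  · obtain ⟨z, h1, h2, -⟩ := hAR y
    refine (affine_apply _ _ _).trans ?_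
    refine (congrArg (fun w => -(τ : 𝕜) • w + (1 : 𝕜) • (-R) y) (h2 _)).trans ?_
    conv_rhs => rw [← h1]
    simp only [_root_.neg_apply]
    module
  · rw [hV]
    ext y
    obtain ⟨z, h1, -, h2⟩ := hAR y
    have h3 : (1 - (2 : 𝕜) • -R) y = y + (2 : 𝕜) • R y := by simp
    rw [h2, h3]
    conv_rhs => lhs; rw [← h1]
    module

/-- If `V` is power bounded by `C`, then so is `(1 - V) / 2`. -/
theorem norm_pow_le_of_eq_one_sub_two_smul {V J : X →L[𝕜] X} (hV : V = 1 - (2 : 𝕜) • J) {C : ℝ}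
    (hC : ∀ n : ℕ, ‖V ^ n‖ ≤ C) (n : ℕ) : ‖J ^ n‖ ≤ C := by
  -- The extra factor `V ^ k` closes the induction: each `J` becomes half the difference of two
  -- terms already bounded by `C`.
  suffices h : ∀ n k : ℕ, ‖J ^ n * V ^ k‖ ≤ C by simpa using h n 0
  have hJ : J = (2⁻¹ : 𝕜) • (1 - V) := by rw [hV]; module
  intro n
  induction n with
  | zero => intro k; simpa using hC k
  | succ n ih =>
    intro k
    have e : J ^ (n + 1) * V ^ k = (2⁻¹ : 𝕜) • (J ^ n * V ^ k - J ^ n * V ^ (k + 1)) := by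
      rw [pow_succ, mul_assoc]
      nth_rewrite 2 [hJ]
      rw [smul_mul_assoc, mul_smul_comm, sub_mul, one_mul, mul_sub, pow_succ' V k]
    rw [e, norm_smul, norm_inv, RCLike.norm_ofNat]
    linarith [norm_sub_le (J ^ n * V ^ k) (J ^ n * V ^ (k + 1)), ih k, ih (k + 1)]

/-- On the domain `J x - x = τ J (A x)` is `O(τ)`; density and the uniform bound do the rest. -/
theorem tendsto_inverse_apply (hA : Dense (A.domain : Set X)) {τ : ℕ → ℝ}
    (hτ : Tendsto τ atTop (𝓝 0)) {J : ℕ → X →L[𝕜] X}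
    (hJ : ∀ n, IsBoundedInverse (affine A (-(τ n : 𝕜)) 1) (J n)) {C : ℝ} (hC : ∀ n, ‖J n‖ ≤ C)
    (x : X) : Tendsto (fun n => J n x) atTop (𝓝 x) := by
  refine tendsto_apply_of_dense (G := 1) hC hA (fun x hx => ?_) x
  refine tendsto_iff_norm_sub_tendsto_zero.2 (squeeze_zero (g := fun n => |τ n| * (C * ‖A ⟨x, hx⟩‖))
    (fun _ => norm_nonneg _) (fun n => ?_) ?_)
  · have h1 : J n x - x = (τ n : 𝕜) • J n (A ⟨x, hx⟩) := (hJ n).apply_sub_self ⟨x, hx⟩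
    rw [one_apply_eq_self, h1, norm_smul, RCLike.norm_ofReal]
    gcongr
    exact (J n).le_of_opNorm_le (hC n) _
  · simpa using hτ.abs.mul_const (C * ‖A ⟨x, hx⟩‖)

/-- A version of the Feller–Miyadera–Phillips generation theorem. -/
theorem exists_isGenerator_of_norm_pow_le [CompleteSpace X] (hA : Dense (A.domain : Set X))
    {τ : ℕ → ℝ} (hτ₀ : ∀ n, 0 < τ n) (hτ : Tendsto τ atTop (𝓝 0)) {J : ℕ → X →L[𝕜] X}
    (hJ : ∀ n, IsBoundedInverse (affine A (-(τ n : 𝕜)) 1) (J n)) {C : ℝ}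
    (hC : ∀ n k, ‖J n ^ k‖ ≤ C) :
    ∃ T : ℝ≥0 → X →L[𝕜] X, IsC0Semigroup T ∧ IsGenerator A T ∧ ∀ t, ‖T t‖ ≤ C := by
  have hτne : ∀ n, (τ n : 𝕜) ≠ 0 := fun n => by exact_mod_cast (hτ₀ n).ne'
  have hC1 : ∀ n, ‖J n‖ ≤ C := fun n => by simpa using hC n 1
  have hone : ∀ S n, Commute S (J n) → Commute S (((τ n)⁻¹ : 𝕜) • (J n - 1)) := fun S n h =>
    (h.sub_right (Commute.one_right _)).smul_right _
  obtain ⟨T, hT, hTC, hcomm, hD⟩ := exists_isC0Semigroup_of_tendsto (𝕜 := 𝕜)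
    (B := fun n => ((τ n)⁻¹ : 𝕜) • (J n - 1)) (M := C) (D := A.domain) (G := fun x => A x)
    (fun n t ht => by
      have h1 := norm_exp_smul_sub_one_le (𝕜 := 𝕜) (hC n) (s := t * (τ n)⁻¹)
        (mul_nonneg ht (inv_nonneg.2 (hτ₀ n).le))
      rwa [RCLike.ofReal_mul, RCLike.ofReal_inv, ← smul_smul] at h1)
    (fun m n => hone _ _ (hone _ _ ((hJ n).commute (hJ m))).symm)
    hA
    (fun x => by
      refine (tendsto_inverse_apply hA hτ hJ hC1 (A x)).congr fun n => ?_
      have h1 := (hJ n).apply_sub_self x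
      change _ = ((τ n)⁻¹ : 𝕜) • (J n x - x)
      rw [h1, smul_smul, inv_mul_cancel₀ (hτne n), one_smul])
  refine ⟨T, hT, fun x y => ⟨fun h => ?_, fun h => ?_⟩, hTC⟩
  · obtain ⟨x, rfl, rfl⟩ := (LinearPMap.mem_graph_iff A).1 h
    exact hD x
  -- Applying `J 0` to the difference quotients moves them into the domain, giving `A (J 0 x) = J 0
  -- y`. Hence `x = J 0 x - τ 0 • A (J 0 x) = J 0 (x - τ 0 • y)` lies in the domain.
  · have hJT : ∀ t, Commute (J 0) (T t) := hcomm _ fun n => hone _ _ ((hJ 0).commute (hJ n))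
    have h1 : Tendsto (fun t : ℝ≥0 => (((t : ℝ)⁻¹ : ℝ) : 𝕜) • (T t (J 0 x) - J 0 x)) (𝓝[>] 0)
        (𝓝 (J 0 y)) := by
      refine (((J 0).continuous.tendsto y).comp h).congr fun t => ?_
      have := congrArg (fun F : X →L[𝕜] X => F x) (hJT t).eq
      simp only [mul_apply_eq_comp] at this
      simp [this]
    have h2 := tendsto_nhds_unique h1 (hD ⟨J 0 x, (hJ 0).mem_domain x⟩)
    have h3 := (hJ 0).sub_apply x
    have hx : x ∈ A.domain := by
      rw [← h3, ← h2, ← map_smul, ← map_sub]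
      exact (hJ 0).mem_domain _
    have h4 := tendsto_nhds_unique h (hD ⟨x, hx⟩)
    rw [h4]
    exact A.mem_graph ⟨x, hx⟩

theorem exists_isGenerator_of_norm_V_pow_le [CompleteSpace X] (hA : Dense (A.domain : Set X))
    {τ₀ : ℝ} (hτ₀ : 0 < τ₀) (hres : ∀ t : ℝ, 1 / τ₀ < t → (t : 𝕜) ∈ resolventSet A) {M : ℝ}
    (hV : ∀ τ : ℝ, 0 < τ → τ < τ₀ → ∀ n : ℕ, 1 ≤ n → ‖V A τ ^ n‖ ≤ M) :
    ∃ T : ℝ≥0 → X →L[𝕜] X, IsC0Semigroup T ∧ IsGenerator A T ∧ ∀ t, ‖T t‖ ≤ M := by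
  obtain ⟨τ, -, hτ, hτlim⟩ := exists_seq_strictAnti_tendsto' hτ₀
  choose J hJ hVJ using fun n => exists_isBoundedInverse_and_V_eq (hτ n).1
    (hres _ (one_div_lt_one_div_of_lt (hτ n).1 (hτ n).2))
  -- The exponent `0` is not covered by `hV`, hence the `max`; it is removed at the end.
  have hVM : ∀ n k, ‖V A (τ n) ^ k‖ ≤ max 1 M := by
    intro n k
    rcases k.eq_zero_or_pos with rfl | hk
    · rw [pow_zero]
      exact ContinuousLinearMap.norm_id_le.trans (le_max_left _ _)
    · exact (hV _ (hτ n).1 (hτ n).2 k hk).trans (le_max_right _ _)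
  have hJM : ∀ n k, ‖J n ^ k‖ ≤ max 1 M := fun n =>
    norm_pow_le_of_eq_one_sub_two_smul (hVJ n) (hVM n)
  obtain ⟨T, hT, hgen, hTM⟩ := exists_isGenerator_of_norm_pow_le hA (fun n => (hτ n).1) hτlim hJ hJM
  refine ⟨T, hT, hgen, fun t => ?_⟩
  have hV1 : ∀ n, ‖V A (τ n)‖ ≤ M := fun n => by simpa using hV _ (hτ n).1 (hτ n).2 1 le_rfl
  have hM : 0 ≤ M := (norm_nonneg _).trans (hV1 0)
  -- `V_τ x → -x` as `τ → 0`, so `M < 1` is only possible on the zero space.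
  have hx : ∀ x : X, ‖x‖ ≤ M * ‖x‖ := fun x => by
    have h1 := (tendsto_inverse_apply hA hτlim hJ (fun n => by rw [← pow_one (J n)]; exact hJM n 1) x).const_smul
      (2 : 𝕜)
    have h2 := (h1.const_sub x).norm
    rw [show x - (2 : 𝕜) • x = -x by module, norm_neg] at h2
    refine le_of_tendsto h2 (Eventually.of_forall fun n => ?_)
    have h3 := (V A (τ n)).le_of_opNorm_le (hV1 n) x
    rw [hVJ n] at h3
    exact h3
  rcases le_or_gt 1 M with h1 | h1
  · exact (hTM t).trans (max_le h1 le_rfl)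
  · refine ContinuousLinearMap.opNorm_le_bound _ hM fun x => ?_
    have hz : ∀ x : X, ‖x‖ = 0 := fun x => by nlinarith [hx x, norm_nonneg x]
    rw [hz, hz, mul_zero]

end Resolvent

end Cogen

theorem theorem3p4 {𝕜 X : Type*} [RCLike 𝕜] [NormedAddCommGroup X] [NormedSpace 𝕜 X]
    [CompleteSpace X] (A : X →ₗ.[𝕜] X) (hA : Dense (A.domain : Set X)) :
    ((∃ τ₀ : ℝ, 0 < τ₀ ∧
        (∀ t : ℝ, 1 / τ₀ < t → (t : 𝕜) ∈ Cogen.resolventSet A) ∧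
        (∀ τ : ℝ, 0 < τ → τ < τ₀ → ‖Cogen.V A τ‖ ≤ 1)) →
      ∃ T : ℝ≥0 → X →L[𝕜] X, Cogen.IsC0Semigroup T ∧ Cogen.IsGenerator A T ∧
        ∀ t : ℝ≥0, ‖T t‖ ≤ 1) ∧
    (∀ M : ℝ, (∃ τ₀ : ℝ, 0 < τ₀ ∧
        (∀ t : ℝ, 1 / τ₀ < t → (t : 𝕜) ∈ Cogen.resolventSet A) ∧
        (∀ τ : ℝ, 0 < τ → τ < τ₀ → ∀ n : ℕ, 1 ≤ n → ‖Cogen.V A τ ^ n‖ ≤ M)) →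
      ∃ T : ℝ≥0 → X →L[𝕜] X, Cogen.IsC0Semigroup T ∧ Cogen.IsGenerator A T ∧
        ∀ t : ℝ≥0, ‖T t‖ ≤ M) := by
  refine ⟨fun ⟨τ₀, hτ₀, hres, hV⟩ => ?_, fun M ⟨τ₀, hτ₀, hres, hV⟩ => ?_⟩
  · exact Cogen.exists_isGenerator_of_norm_V_pow_le hA hτ₀ hres fun τ h0 h1 n hn =>
      (norm_pow_le' _ hn).trans (pow_le_one₀ (norm_nonneg _) (hV τ h0 h1))
  · exact Cogen.exists_isGenerator_of_norm_V_pow_le hA hτ₀ hres hV
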